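/- Let $F$ be a field; put $p(F)=p$ if $F$ has prime characteristic $p$, and $p(F)=+\infty$ if $F$ has characteristic $0$. For $a\in\mathbb Z$ and an integer $k\ge 1$ let $\{a\}_k\in\{0,\dots,k-1\}$ be the least nonnegative residue of $a$ modulo $k$, and let $[P]=1$ if the predicate $P$ holds and $[P]=0$ otherwise. (1) Let $k\ge 1$ be any integer, let $A_1,\dots,A_n$ be finite subsets of $F$ with $|A_1|=\dots=|A_n|=m\ge n$, and let $f(x_1,\dots,x_n)=x_1^k+\dots+x_n^k+g(x_1,\dots,x_n)\in F[x_1,\dots,x_n]$ with $\deg g<k$. Then $$\bigl|\{f(x_1,\dots,x_n): x_1\in A_1,\dots,x_n\in A_n,\ x_i\ne x_j\text{ if }i\ne j\}\bigr|\ \ge\ \min\Bigl\{p(F),\ \frac{n(m-n)-\{n\}_k\{m-n\}_k}{k}+\{m\}_k\,\bigl[\{m\}_k<\{n\}_k\bigr]+1\Bigr\}.$$ (2) Sun's conjecture holds when all leading coefficients are equal: let $1\le k\le n$ be integers, let $a_1=\dots=a_n\in F\setminus\{0\}$, and let $f=a_1x_1^k+\dots+a_nx_n^k+g\in F[x_1,\dots,x_n]$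 with $\deg g<k$. Then for every finite $A\subseteq F$, $$\bigl|\{f(x_1,\dots,x_n): x_1,\dots,x_n\in A,\ x_i\ne x_j\text{ if }i\ne j\}\bigr|\ \ge\ \min\Bigl\{p(F)-[n=2\text{ and }a_1=-a_2],\ \frac{n(|A|-n)-\{n\}_k\{|A|-n\}_k}{k}+1\Bigr\}.$$ (3) (Dias da Silva–Hamidoune) For every $n$ and every finite $A\subseteq F$, $$\bigl|\{x_1+\dots+x_n: x_1,\dots,x_n\in A,\ x_i\ne x_j\text{ if }i\ne j\}\bigr|\ \ge\ \min\{p(F),\ n(|A|-n)+1\}.$$ -/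

import Mathlib

open MvPolynomial

noncomputable section

/-- `p(F)`: the characteristic of `F` if it is a prime, and `+∞` if it is zero. -/
def charOrTop (F : Type*) [Field F] : EReal :=
  if ringChar F = 0 then ⊤ else ((ringChar F : ℝ) : EReal)

/-- The Iverson bracket of a predicate. -/
def iverson (P : Prop) : ℝ := open Classical in if P then 1 else 0

/-- `{a}_k`: the least nonnegative residue of the integer `a` modulo `k ≥ 1`. -/
def leastResidue (a : ℤ) (k : ℕ) : ℝ := ((a % (k : ℤ) : ℤ) : ℝ)

/-- The set of values `f(x_1, …, x_n)` with `x_i ∈ A_i` pairwise distinct. -/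
def restrictedValueSet {F : Type*} [Field F] {n : ℕ}
    (A : Fin n → Finset F) (f : MvPolynomial (Fin n) F) : Set F :=
  {y | ∃ x : Fin n → F, (∀ i, x i ∈ A i) ∧ (∀ i j, i ≠ j → x i ≠ x j) ∧ eval x f = y}

/-- The restricted value set is finite, so that its `ncard` is its number of elements. -/
theorem restrictedValueSet_finite {F : Type*} [Field F] {n : ℕ}
    (A : Fin n → Finset F) (f : MvPolynomial (Fin n) F) :
    (restrictedValueSet A f).Finite := by
  have h : (Set.pi Set.univ (fun i => (A i : Set F))).Finite :=
    Set.Finite.pi fun i => (A i).finite_toSet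
  refine (h.image (fun x => eval x f)).subset ?_
  rintro y ⟨x, hx, -, rfl⟩
  exact ⟨x, fun i _ => hx i, rfl⟩

end

open MvPolynomial

noncomputable section

/-- `h` is homogeneous of degree `N` and is the degree `N` part of `q`, whose other terms all have
lower degree. -/
def IsTopForm {σ R : Type*} [CommRing R] (q h : MvPolynomial σ R) (N : ℕ) : Prop :=
  (∀ d, coeff d h ≠ 0 → d.degree = N) ∧ ∀ d, coeff d (q - h) ≠ 0 → d.degree < N

namespace IsTopForm

variable {σ R : Type*} [CommRing R]

theorem degree_le {q h : MvPolynomial σ R} {N : ℕ} (H : IsTopForm q h N) {d : σ →₀ ℕ}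
    (hd : coeff d q ≠ 0) : d.degree ≤ N := by
  by_cases h0 : coeff d h = 0
  · exact (H.2 d (by simpa [h0] using hd)).le
  · exact (H.1 d h0).le

theorem totalDegree_le {q h : MvPolynomial σ R} {N : ℕ} (H : IsTopForm q h N) :
    q.totalDegree ≤ N := by
  refine Finset.sup_le fun d hd => ?_
  exact H.degree_le (mem_support_iff.1 hd)

theorem coeff_eq {q h : MvPolynomial σ R} {N : ℕ} (H : IsTopForm q h N) {d : σ →₀ ℕ}
    (hd : d.degree = N) : coeff d q = coeff d h := by
  by_contra hne
  exact (H.2 d (by simpa [sub_eq_zero] using hne)).ne hd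

theorem refl {h : MvPolynomial σ R} {N : ℕ} (H : ∀ d, coeff d h ≠ 0 → d.degree = N) :
    IsTopForm h h N := ⟨H, by simp⟩

theorem exists_of_coeff_mul_ne_zero {q r : MvPolynomial σ R} {d : σ →₀ ℕ}
    (h : coeff d (q * r) ≠ 0) : ∃ a b, d.degree = a.degree + b.degree ∧
      coeff a q ≠ 0 ∧ coeff b r ≠ 0 := by
  classical
  rw [coeff_mul] at h
  obtain ⟨⟨a, b⟩, hab, hne⟩ := Finset.exists_ne_zero_of_sum_ne_zero h
  rw [Finset.HasAntidiagonal.mem_antidiagonal] at hab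
  refine ⟨a, b, ?_, left_ne_zero_of_mul hne, right_ne_zero_of_mul hne⟩
  rw [← hab]
  simp

theorem mul {q₁ h₁ q₂ h₂ : MvPolynomial σ R} {N₁ N₂ : ℕ} (H₁ : IsTopForm q₁ h₁ N₁)
    (H₂ : IsTopForm q₂ h₂ N₂) : IsTopForm (q₁ * q₂) (h₁ * h₂) (N₁ + N₂) := by
  refine ⟨fun d hd => ?_, fun d hd => ?_⟩
  · obtain ⟨a, b, hab, ha, hb⟩ := exists_of_coeff_mul_ne_zero hd
    rw [hab, H₁.1 a ha, H₂.1 b hb]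
  · have hsplit : q₁ * q₂ - h₁ * h₂ = (q₁ - h₁) * q₂ + h₁ * (q₂ - h₂) := by ring
    rw [hsplit, coeff_add] at hd
    by_cases h0 : coeff d ((q₁ - h₁) * q₂) = 0
    · rw [h0, zero_add] at hd
      obtain ⟨a, b, hab, ha, hb⟩ := exists_of_coeff_mul_ne_zero hd
      have := H₁.1 a ha
      have := H₂.2 b hb
      omega
    · obtain ⟨a, b, hab, ha, hb⟩ := exists_of_coeff_mul_ne_zero h0
      have := H₁.2 a ha
      have := H₂.degree_le hb
      omega

theorem one : IsTopForm (1 : MvPolynomial σ R) 1 0 := by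
  classical
  refine refl fun d hd => ?_
  rw [coeff_one] at hd
  have : 0 = d := by
    by_contra h
    simp [h] at hd
  simp [← this]

theorem prod {ι : Type*} (s : Finset ι) {q : ι → MvPolynomial σ R} {h : MvPolynomial σ R} {N : ℕ}
    (H : ∀ i ∈ s, IsTopForm (q i) h N) : IsTopForm (∏ i ∈ s, q i) (h ^ s.card) (N * s.card) := by
  classical
  induction s using Finset.induction_on with
  | empty => simpa using one
  | insert a s ha ih =>
    rw [Finset.prod_insert ha, Finset.card_insert_of_notMem ha, pow_succ', Nat.mul_succ, add_comm]
    exact (H a (by simp)).mul (ih fun i hi => H i (by simp [hi]))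

end IsTopForm

section Coefficient

variable {R : Type*} [CommRing R] {n : ℕ}

theorem coeff_monomial_mul_powerSum_pow (k s : ℕ) (hk : 0 < k) (t e : Fin n → ℕ)
    (hsum : ∑ i, e i = ∑ i, t i + k * s) :
    coeff (Finsupp.equivFunOnFinite.symm e)
        ((∏ i, (X i : MvPolynomial (Fin n) R) ^ t i) * (∑ i, X i ^ k) ^ s) *
      ∏ i, ((e i / k).factorial : R) =
    s.factorial * ∏ i, (if e i % k = t i % k then ((e i / k).descFactorial (t i / k) : R) else 0) := by
  classical
  have hexp : ∀ κ : Fin n → ℕ, coeff (Finsupp.equivFunOnFinite.symm e)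
      ((∏ i, (X i : MvPolynomial (Fin n) R) ^ t i) *
        ((Nat.multinomial Finset.univ κ : MvPolynomial (Fin n) R) * ∏ i, (X i ^ k) ^ κ i)) =
      if ∀ i, e i = t i + k * κ i then (Nat.multinomial Finset.univ κ : R) else 0 := by
    intro κ
    have : (∏ i, (X i : MvPolynomial (Fin n) R) ^ t i) *
        ((Nat.multinomial Finset.univ κ : MvPolynomial (Fin n) R) * ∏ i, (X i ^ k) ^ κ i) =
        C (Nat.multinomial Finset.univ κ : R) * ∏ i, X i ^ (t i + k * κ i) := by
      simp only [pow_add, pow_mul, Finset.prod_mul_distrib, map_natCast]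
      ring
    rw [this, coeff_C_mul, coeff_prod_X_pow]
    simp [Finsupp.ext_iff]
  rw [Finset.sum_pow_eq_sum_piAntidiag, Finset.mul_sum, coeff_sum]
  simp only [hexp]
  by_cases h : ∃ κ : Fin n → ℕ, ∀ i, e i = t i + k * κ i
  · obtain ⟨κ, hκ⟩ := h
    have hκs : ∑ i, κ i = s := by
      simp only [hκ, Finset.sum_add_distrib, ← Finset.mul_sum] at hsum
      exact Nat.eq_of_mul_eq_mul_left hk (by omega)
    rw [Finset.sum_eq_single κ]
    · rw [if_pos hκ, ← hκs, ← Nat.multinomial_spec]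
      push_cast
      rw [mul_right_comm, ← Finset.prod_mul_distrib, mul_comm]
      refine congrArg (· * _) (Finset.prod_congr rfl fun i _ => ?_)
      have hdiv : e i / k = t i / k + κ i := by rw [hκ, Nat.add_mul_div_left _ _ hk]
      rw [if_pos (by rw [hκ, Nat.add_mul_mod_self_left]), hdiv,
        ← Nat.factorial_mul_descFactorial (Nat.le_add_right (t i / k) (κ i))]
      push_cast [Nat.add_sub_cancel_left]
      ring
    · intro κ' _ hne
      rw [if_neg]
      intro hκ'
      refine hne (funext fun i => Nat.eq_of_mul_eq_mul_left hk ?_)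
      have := hκ i
      have := hκ' i
      omega
    · intro hmem
      exact absurd (Finset.mem_piAntidiag.2 ⟨hκs, by simp⟩) hmem
  · rw [Finset.sum_eq_zero fun κ _ => if_neg fun hκ => h ⟨κ, hκ⟩, zero_mul]
    have : ∃ i, (if e i % k = t i % k then ((e i / k).descFactorial (t i / k) : R) else 0) = 0 := by
      by_contra! hne
      refine h ⟨fun i => e i / k - t i / k, fun i => ?_⟩
      have hi := hne i
      have hmod : e i % k = t i % k := by
        by_contra hm
        simp [hm] at hi
      rw [if_pos hmod] at hi
      have hle : t i / k ≤ e i / k := by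
        by_contra! hlt
        rw [Nat.descFactorial_eq_zero_iff_lt.2 hlt] at hi
        simp at hi
      have h1 := Nat.mod_add_div (e i) k
      have h2 := Nat.mod_add_div (t i) k
      rw [Nat.mul_sub]
      have := Nat.mul_le_mul_left k hle
      omega
    obtain ⟨i, hi⟩ := this
    rw [Finset.prod_eq_zero (Finset.mem_univ i) hi, mul_zero]

/-- The matrix of falling factorials of the quotients by `k`, supported on congruent indices. -/
def residueDescFactorialMatrix (R : Type*) [CommRing R] (k : ℕ) (e : Fin n → ℕ) :
    Matrix (Fin n) (Fin n) R :=
  Matrix.of fun i j =>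
    if e i % k = j % k then ((e i / k).descFactorial (j / k) : R) else 0

theorem coeff_vandermonde_mul_powerSum_pow (k s : ℕ) (hk : 0 < k) (e : Fin n → ℕ)
    (hsum : ∑ i, e i = ∑ i : Fin n, (i : ℕ) + k * s) :
    coeff (Finsupp.equivFunOnFinite.symm e)
        ((Matrix.vandermonde (X : Fin n → MvPolynomial (Fin n) R)).det * (∑ i, X i ^ k) ^ s) *
      ∏ i, ((e i / k).factorial : R) =
    s.factorial * (residueDescFactorialMatrix R k e).det := by
  rw [← Matrix.det_transpose, Matrix.det_apply, ← Matrix.det_transpose, Matrix.det_apply,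
    Finset.sum_mul, coeff_sum, Finset.sum_mul, Finset.mul_sum]
  refine Finset.sum_congr rfl fun σ _ => ?_
  have key := coeff_monomial_mul_powerSum_pow (R := R) k s hk (fun i => (σ i : ℕ)) e
    (by rw [hsum, Equiv.sum_comp σ (fun i : Fin n => (i : ℕ))])
  simp only [Matrix.transpose_apply, Matrix.vandermonde_apply, residueDescFactorialMatrix,
    Matrix.of_apply]
  rw [smul_mul_assoc, coeff_smul, smul_mul_assoc, key, mul_smul_comm]

theorem det_residueDescFactorialMatrix_ne_zero {F : Type*} [Field F] {k : ℕ} (hk : 0 < k)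
    {e : Fin n → ℕ} (hmod : ∀ i, e i % k = i % k)
    (hinj : ∀ i j : Fin n, (i : ℕ) % k = j % k → ((e i / k : ℕ) : F) = (e j / k : ℕ) → i = j) :
    (residueDescFactorialMatrix F k e).det ≠ 0 := by
  classical
  intro hdet
  obtain ⟨v, hv0, hv⟩ := Matrix.exists_mulVec_eq_zero_iff.2 hdet
  obtain ⟨j, hj, hmax⟩ : ∃ j, v j ≠ 0 ∧ ∀ i, v i ≠ 0 → i ≤ j := by
    have hne : (Finset.univ.filter fun i => v i ≠ 0).Nonempty := by
      obtain ⟨i, hi⟩ := Function.ne_iff.1 hv0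
      exact ⟨i, by simpa using hi⟩
    refine ⟨_, (Finset.mem_filter.1 (Finset.max'_mem _ hne)).2, fun i hi => ?_⟩
    exact Finset.le_max' _ _ (by simpa using hi)
  set q : Polynomial F := ∑ i : Fin n,
    if (i : ℕ) % k = j % k then Polynomial.C (v i) * descPochhammer F (i / k) else 0 with hq
  have hlow : ∀ i : Fin n, i ≠ j → (i : ℕ) % k = j % k → v i ≠ 0 → (i : ℕ) / k < j / k := by
    intro i hij hm hvi
    have h1 := Nat.mod_add_div (i : ℕ) k
    have h2 := Nat.mod_add_div (j : ℕ) k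
    have h3 : (i : ℕ) < j := lt_of_le_of_ne (hmax i hvi) (fun h => hij (Fin.ext h))
    by_contra! hle
    have := Nat.mul_le_mul_left k hle
    omega
  have hdeg : q.natDegree ≤ (j : ℕ) / k := by
    refine Polynomial.natDegree_sum_le_of_forall_le _ _ fun i _ => ?_
    split_ifs with hm
    · by_cases hvi : v i = 0
      · simp [hvi]
      · refine (Polynomial.natDegree_C_mul_le _ _).trans ?_
        rw [descPochhammer_natDegree]
        exact Nat.div_le_div_right (hmax i hvi)
    · simp
  have hcoeff : q.coeff ((j : ℕ) / k) = v j := by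
    rw [hq, Polynomial.finsetSum_coeff, Finset.sum_eq_single j]
    · have := (monic_descPochhammer F ((j : ℕ) / k)).coeff_natDegree
      rw [descPochhammer_natDegree] at this
      simp [this]
    · intro i _ hij
      split_ifs with hm
      · by_cases hvi : v i = 0
        · simp [hvi]
        · rw [Polynomial.coeff_C_mul, Polynomial.coeff_eq_zero_of_natDegree_lt, mul_zero]
          rw [descPochhammer_natDegree]
          exact hlow i hij hm hvi
      · simp
    · simp
  have heval : ∀ i : Fin n, (i : ℕ) % k = j % k → q.eval ((e i / k : ℕ) : F) = 0 := by
    intro i hi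
    have := congrFun hv i
    rw [Matrix.mulVec, dotProduct, Pi.zero_apply] at this
    rw [← this, hq, Polynomial.eval_finsetSum]
    refine Finset.sum_congr rfl fun l _ => ?_
    simp only [residueDescFactorialMatrix, Matrix.of_apply, hmod i, hi]
    by_cases hl : (l : ℕ) % k = j % k
    · rw [if_pos hl, if_pos hl.symm, Polynomial.eval_mul, Polynomial.eval_C,
        descPochhammer_eval_eq_descFactorial, mul_comm]
    · rw [if_neg hl, if_neg (Ne.symm hl)]
      simp
  have hlt : ∀ t : Fin (j / k + 1), (j : ℕ) % k + k * t < n := by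
    intro t
    have h2 := Nat.mod_add_div (j : ℕ) k
    have := Nat.mul_le_mul_left k (Nat.lt_succ_iff.1 t.2)
    have := j.2
    omega
  have hclass : ∀ t : Fin (j / k + 1), ((j : ℕ) % k + k * t) % k = j % k := by
    intro t
    simp
  have hzero : q = 0 := by
    refine Polynomial.eq_zero_of_natDegree_lt_card_of_eval_eq_zero q
      (f := fun t : Fin (j / k + 1) => ((e ⟨_, hlt t⟩ / k : ℕ) : F)) ?_
      (fun t => heval _ (hclass t)) (by simpa using Nat.lt_succ_of_le hdeg)
    intro t t' htt
    have := hinj _ _ ((hclass t).trans (hclass t').symm) htt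
    rw [Fin.mk.injEq] at this
    exact Fin.ext (Nat.eq_of_mul_eq_mul_left hk (by omega))
  rw [hzero, Polynomial.coeff_zero] at hcoeff
  exact hj hcoeff.symm

end Coefficient

/-- Every polynomial `∑ X_i ^ k + g` with `deg g < k` takes more than `s` values at points with
distinct coordinates taken from sets of size at least `m`. -/
def PowerSumValuesExceed (F : Type*) [Field F] (k n m s : ℕ) : Prop :=
  ∀ A : Fin n → Finset F, (∀ i, m ≤ (A i).card) → ∀ g : MvPolynomial (Fin n) F,
    g.totalDegree < k → s < (restrictedValueSet A ((∑ i, X i ^ k) + g)).ncard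

theorem isTopForm_powerSum_add {F : Type*} [Field F] {n k : ℕ} {g : MvPolynomial (Fin n) F}
    (hg : g.totalDegree < k) : IsTopForm ((∑ i, X i ^ k) + g) (∑ i, X i ^ k) k := by
  classical
  refine ⟨fun d hd => ?_, fun d hd => ?_⟩
  · rw [coeff_sum] at hd
    obtain ⟨i, -, hi⟩ := Finset.exists_ne_zero_of_sum_ne_zero hd
    rw [coeff_X_pow] at hi
    have : Finsupp.single i k = d := by
      by_contra h
      simp [h] at hi
    simp [← this]
  · rw [add_sub_cancel_left] at hd
    exact (le_totalDegree (mem_support_iff.2 hd)).trans_lt hg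

theorem isTopForm_det_vandermonde {F : Type*} [Field F] (n : ℕ) :
    IsTopForm (Matrix.vandermonde (X : Fin n → MvPolynomial (Fin n) F)).det
      (Matrix.vandermonde (X : Fin n → MvPolynomial (Fin n) F)).det (∑ i : Fin n, (i : ℕ)) := by
  classical
  refine IsTopForm.refl fun d hd => ?_
  rw [← Matrix.det_transpose, Matrix.det_apply, coeff_sum] at hd
  obtain ⟨σ, -, hσ⟩ := Finset.exists_ne_zero_of_sum_ne_zero hd
  simp only [Matrix.transpose_apply, Matrix.vandermonde_apply] at hσ
  rw [coeff_smul, coeff_prod_X_pow] at hσ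
  have : d = Finsupp.indicator Finset.univ fun i _ => (σ i : ℕ) := by
    by_contra h
    simp [h] at hσ
  rw [this, Finsupp.degree_eq_sum, ← Equiv.sum_comp σ (fun i : Fin n => (i : ℕ))]
  simp

theorem powerSumValuesExceed_of_exponents {F : Type*} [Field F] {k n m s : ℕ} (hk : 0 < k)
    (hs : (s.factorial : F) ≠ 0) {e : Fin n → ℕ} (he : ∀ i, e i < m)
    (hmod : ∀ i, e i % k = i % k) (hsum : ∑ i, e i = ∑ i : Fin n, (i : ℕ) + k * s)
    (hinj : ∀ i j : Fin n, (i : ℕ) % k = j % k → ((e i / k : ℕ) : F) = (e j / k : ℕ) → i = j) :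
    PowerSumValuesExceed F k n m s := by
  classical
  intro A hA g hg
  by_contra! hcard
  set f : MvPolynomial (Fin n) F := (∑ i, X i ^ k) + g with hf
  have hfin := restrictedValueSet_finite A f
  rw [Set.ncard_eq_toFinset_card _ hfin] at hcard
  set V := hfin.toFinset
  set Δ := (Matrix.vandermonde (X : Fin n → MvPolynomial (Fin n) F)).det with hΔ
  have hfactor : ∀ c : F, IsTopForm (f - C c) (∑ i, X i ^ k) k := by
    intro c
    rw [hf, add_sub_assoc]
    exact isTopForm_powerSum_add ((totalDegree_sub_C_le _ _).trans_lt hg)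
  have htop := (isTopForm_det_vandermonde (F := F) n).mul
    ((IsTopForm.prod V fun c _ => hfactor c).mul
      (IsTopForm.prod (Finset.range (s - V.card)) fun _ _ => hfactor 0))
  rw [← pow_add, ← mul_add, Finset.card_range, Nat.add_sub_cancel' hcard] at htop
  set P := Δ * ((∏ c ∈ V, (f - C c)) * ∏ i ∈ Finset.range (s - V.card), (f - C 0))
  set E := Finsupp.equivFunOnFinite.symm e with hE
  have hEdeg : E.degree = ∑ i : Fin n, (i : ℕ) + k * s := by
    rw [← hsum, Finsupp.degree_eq_sum]
    simp [hE]
  have hcoeff : coeff E P ≠ 0 := by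
    rw [htop.coeff_eq hEdeg]
    have := coeff_vandermonde_mul_powerSum_pow (R := F) k s hk e hsum
    refine left_ne_zero_of_mul (this.trans_ne (mul_ne_zero hs ?_))
    exact det_residueDescFactorialMatrix_ne_zero hk hmod hinj
  obtain ⟨x, hxA, hx⟩ := combinatorial_nullstellensatz_exists_eval_nonzero P E hcoeff
    (le_antisymm (htop.totalDegree_le.trans hEdeg.ge)
      (le_totalDegree (mem_support_iff.2 hcoeff)))
    A (fun i => (he i).trans_le (hA i))
  rw [eval_mul, eval_mul, eval_prod] at hx
  have hxinj : Function.Injective x := by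
    rw [← Matrix.det_vandermonde_ne_zero_iff]
    convert left_ne_zero_of_mul hx
    rw [hΔ, RingHom.map_det]
    congr 1
    ext i j
    simp [Matrix.vandermonde_apply]
  refine left_ne_zero_of_mul (right_ne_zero_of_mul hx) ?_
  refine Finset.prod_eq_zero (i := eval x f) ?_ (by simp)
  exact hfin.mem_toFinset.2 ⟨x, hxA, fun i j hij h => hij (hxinj h), rfl⟩

theorem PowerSumValuesExceed.mono {F : Type*} [Field F] {k n m m' s : ℕ} (hm : m ≤ m')
    (h : PowerSumValuesExceed F k n m s) : PowerSumValuesExceed F k n m' s :=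
  fun A hA g hg => h A (fun i => hm.trans (hA i)) g hg

theorem PowerSumValuesExceed.succ {F : Type*} [Field F] {k n m s : ℕ}
    (h : PowerSumValuesExceed F k n m s) : PowerSumValuesExceed F k (n + 1) (m + 1) s := by
  classical
  intro A hA g hg
  obtain ⟨a, ha⟩ : (A 0).Nonempty := Finset.card_pos.1 (by have := hA 0; omega)
  let φ : MvPolynomial (Fin (n + 1)) F →ₐ[F] MvPolynomial (Fin n) F :=
    aeval (Fin.cons (C a) X)
  have hφ : ∀ p x, eval x (φ p) = eval (Fin.cons a x) p := by
    intro p x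
    induction p using MvPolynomial.induction_on with
    | C b => simp [φ]
    | add p q hp hq => rw [map_add, map_add, map_add, hp, hq]
    | mul_X p i hp =>
      rw [map_mul, map_mul, map_mul, hp, eval_X]
      refine congrArg _ ?_
      refine Fin.cases ?_ (fun i => ?_) i <;> simp [φ]
  have hdeg : (φ g).totalDegree ≤ g.totalDegree := by
    have : φ g = _ := aeval_def _ _
    rw [this, eval₂_eq']
    refine totalDegree_finsetSum_le fun d hd => ?_
    refine (totalDegree_mul _ _).trans ?_
    rw [algebraMap_eq, totalDegree_C, zero_add]
    refine ((totalDegree_finsetProd _ _).trans (Finset.sum_le_sum (g := d) fun i _ => ?_)).trans ?_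
    · refine (totalDegree_pow _ _).trans ?_
      refine (Nat.mul_le_mul_left _ ?_).trans (Nat.mul_one _).le
      refine Fin.cases ?_ (fun i => ?_) i <;> simp
    · rw [← Finsupp.degree_eq_sum]
      exact le_totalDegree hd
  have := h (fun i => (A i.succ).erase a)
    (fun i => by have := Finset.pred_card_le_card_erase (s := A i.succ) (a := a)
                 have := hA i.succ
                 omega)
    (C (a ^ k) + φ g)
    ((totalDegree_add _ _).trans_lt (max_lt (by rw [totalDegree_C]; omega) (hdeg.trans_lt hg)))
  refine this.trans_le (Set.ncard_le_ncard ?_ (restrictedValueSet_finite _ _))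
  rintro y ⟨x, hxA, hx, rfl⟩
  refine ⟨Fin.cons a x, ?_, ?_, ?_⟩
  · intro i
    refine Fin.cases ha (fun i => ?_) i
    simpa using Finset.mem_of_mem_erase (hxA i)
  · have : Function.Injective (Fin.cons a x : Fin (n + 1) → F) := by
      rw [Fin.cons_injective_iff]
      refine ⟨?_, fun i j hij => by_contra fun hne => hx i j hne hij⟩
      rintro ⟨i, hi⟩
      exact Finset.ne_of_mem_erase (hxA i) hi
    exact fun i j hij hne => hij (this hne)
  · simp [hφ, Fin.sum_univ_succ]
    ring

theorem PowerSumValuesExceed.add {F : Type*} [Field F] {k n m s : ℕ} (t : ℕ)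
    (h : PowerSumValuesExceed F k n m s) : PowerSumValuesExceed F k (n + t) (m + t) s := by
  induction t with
  | zero => exact h
  | succ t ih => exact ih.succ

theorem powerSumValuesExceed_zero {F : Type*} [Field F] {k n m : ℕ} (hnm : n ≤ m) :
    PowerSumValuesExceed F k n m 0 := by
  have h0 : PowerSumValuesExceed F k 0 0 0 := by
    intro A _ g _
    exact (Set.ncard_pos (restrictedValueSet_finite _ _)).2
      ⟨_, Fin.elim0, fun i => i.elim0, fun i => i.elim0, rfl⟩
  have := h0.add n
  rw [zero_add] at this
  exact this.mono hnm

/-- The number of `i < n` congruent to `r` modulo `k`, for `r < k`. -/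
def residueCount (k n r : ℕ) : ℕ := (n + k - 1 - r) / k

theorem div_lt_residueCount_iff {k : ℕ} (hk : 0 < k) (n e : ℕ) :
    e / k < residueCount k n (e % k) ↔ e < n := by
  rw [residueCount, ← Nat.add_one_le_iff, Nat.le_div_iff_mul_le hk, Nat.add_mul, Nat.mul_comm]
  have h1 := Nat.mod_add_div e k
  have h2 := Nat.mod_lt e hk
  omega

theorem residueCount_mono {k n m : ℕ} (h : n ≤ m) (r : ℕ) :
    residueCount k n r ≤ residueCount k m r :=
  Nat.div_le_div_right (by omega)

theorem residueCount_eq {k a b r : ℕ} (hr : r < k) (hb : b < k) :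
    residueCount k (k * a + b) r = a + if r < b then 1 else 0 := by
  have hk : 0 < k := by omega
  rw [residueCount]
  split_ifs with h
  · rw [show k * a + b + k - 1 - r = (b - 1 - r) + k * (a + 1) by rw [Nat.mul_add]; omega,
      Nat.add_mul_div_left _ _ hk, Nat.div_eq_of_lt (by omega)]
    omega
  · rw [show k * a + b + k - 1 - r = (b + k - 1 - r) + k * a by omega,
      Nat.add_mul_div_left _ _ hk, Nat.div_eq_of_lt (by omega)]
    omega

/-- The largest value of `(∑ e_i - ∑ i) / k` over distinct exponents `e_0, …, e_{n-1} < m` with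
`e_i` congruent to `i` modulo `k`. -/
def maxExcess (k n m : ℕ) : ℕ :=
  ∑ i : Fin n, (residueCount k m (i % k) - residueCount k n (i % k))

theorem sum_range_mul_add_mod {k : ℕ} (h : ℕ → ℤ) (a : ℕ) {b : ℕ} (hb : b < k) :
    ∑ i ∈ Finset.range (k * a + b), h (i % k) =
      a * ∑ r ∈ Finset.range k, h r + ∑ r ∈ Finset.range b, h r := by
  have hblock : ∀ c ≤ k, ∀ a, ∑ i ∈ Finset.range c, h ((k * a + i) % k) =
      ∑ i ∈ Finset.range c, h i := fun c hc a => Finset.sum_congr rfl fun i hi => by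
    rw [Nat.mul_add_mod, Nat.mod_eq_of_lt ((Finset.mem_range.1 hi).trans_le hc)]
  have hmul : ∀ a : ℕ, ∑ i ∈ Finset.range (k * a), h (i % k) = a * ∑ r ∈ Finset.range k, h r := by
    intro a
    induction a with
    | zero => simp
    | succ a ih =>
      rw [Nat.mul_succ, Finset.sum_range_add, ih, hblock k le_rfl]
      push_cast
      ring
  rw [Finset.sum_range_add, hmul, hblock b hb.le]

theorem sum_range_ite_lt (c b : ℕ) :
    ∑ r ∈ Finset.range c, (if r < b then (1 : ℤ) else 0) = min c b := by
  induction c with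
  | zero => simp
  | succ c ih =>
    rw [Finset.sum_range_succ, ih]
    split_ifs <;> omega

theorem maxExcess_eq {k a b c d : ℕ} (hb : b < k) (hd : d < k) (hle : k * a + b ≤ k * c + d) :
    (maxExcess k (k * a + b) (k * c + d) : ℤ) =
      a * (k * (c - a) + d - b) + b * (c - a) + min b d - b := by
  have hk : 0 < k := by omega
  have hsum : (maxExcess k (k * a + b) (k * c + d) : ℤ) =
      ∑ i ∈ Finset.range (k * a + b), ((fun r : ℕ => ((c : ℤ) - a) + (if r < d then (1 : ℤ) else 0)
        - (if r < b then (1 : ℤ) else 0)) (i % k)) := by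
    rw [maxExcess, ← Fin.sum_univ_eq_sum_range, Nat.cast_sum]
    refine Finset.sum_congr rfl fun i _ => ?_
    rw [Nat.cast_sub (residueCount_mono hle _), residueCount_eq (Nat.mod_lt _ hk) hb,
      residueCount_eq (Nat.mod_lt _ hk) hd]
    push_cast
    ring
  rw [hsum]
  refine (sum_range_mul_add_mod (fun r : ℕ => ((c : ℤ) - a) + (if r < d then (1 : ℤ) else 0)
    - (if r < b then (1 : ℤ) else 0)) a hb).trans ?_
  simp only [Finset.sum_sub_distrib, Finset.sum_add_distrib, sum_range_ite_lt, Finset.sum_const,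
    Finset.card_range, nsmul_eq_mul]
  rw [min_eq_right hd.le, min_eq_right hb.le, min_self]
  ring

theorem exists_monotone_on_classes {n : ℕ} {ι : Type*} (cls : Fin n → ι) (W : ι → ℕ) (s : ℕ)
    (hs : s ≤ ∑ i, W (cls i)) :
    ∃ l : Fin n → ℕ, (∀ i, l i ≤ W (cls i)) ∧ (∀ i j, i < j → cls i = cls j → l i ≤ l j) ∧
      ∑ i, l i = s := by
  classical
  induction s with
  | zero => exact ⟨0, fun _ => Nat.zero_le _, fun _ _ _ _ => le_rfl, by simp⟩
  | succ s ih =>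
    obtain ⟨l, hl, hmono, hsum⟩ := ih (by omega)
    have hne : (Finset.univ.filter fun i => l i < W (cls i)).Nonempty := by
      by_contra h
      rw [Finset.not_nonempty_iff_eq_empty, Finset.filter_eq_empty_iff] at h
      have := Finset.sum_le_sum fun i (hi : i ∈ Finset.univ) => not_lt.1 (h hi)
      omega
    set i₀ := Finset.max' _ hne with hi₀
    have hlt : l i₀ < W (cls i₀) := (Finset.mem_filter.1 (Finset.max'_mem _ hne)).2
    have hmax : ∀ j, i₀ < j → l j = W (cls j) := by
      intro j hj
      by_contra hne'
      refine absurd (Finset.le_max' _ j ?_) (not_le.2 hj)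
      exact Finset.mem_filter.2 ⟨Finset.mem_univ _, lt_of_le_of_ne (hl j) hne'⟩
    refine ⟨Function.update l i₀ (l i₀ + 1), fun i => ?_, fun i j hij hc => ?_, ?_⟩
    · by_cases h : i = i₀
      · subst h
        simpa using hlt
      · simpa [h] using hl i
    · have := hmono i j hij hc
      by_cases h : i = i₀
      · have hj : j ≠ i₀ := by
          rintro rfl
          exact hij.ne h
        rw [h, Function.update_self, Function.update_of_ne hj, hmax j (h ▸ hij), ← hc, h]
        exact hlt
      · rw [Function.update_of_ne h]
        by_cases hj : j = i₀
        · rw [hj] at this ⊢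
          rw [Function.update_self]
          omega
        · rwa [Function.update_of_ne hj]
    · rw [Finset.sum_update_of_mem (Finset.mem_univ _), ← hsum,
        ← Finset.add_sum_erase _ _ (Finset.mem_univ i₀), Finset.sdiff_singleton_eq_erase]
      ring

theorem powerSumValuesExceed_of_le_maxExcess {F : Type*} [Field F] {k n m s : ℕ} (hk : 0 < k)
    (hnm : n ≤ m) (hs : s ≤ maxExcess k n m)
    (hp : ringChar F = 0 ∨ (s < ringChar F ∧ m ≤ k * ringChar F)) :
    PowerSumValuesExceed F k n m s := by
  obtain ⟨l, hl, hmono, hsum⟩ := exists_monotone_on_classes (fun i : Fin n => (i : ℕ) % k)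
    (fun r => residueCount k m r - residueCount k n r) s hs
  have hdiv : ∀ i : Fin n, (i + k * l i) / k = i / k + l i :=
    fun i => Nat.add_mul_div_left _ _ hk
  have hmod : ∀ i : Fin n, (i + k * l i) % k = i % k := fun i => Nat.add_mul_mod_self_left _ _ _
  have hlt : ∀ i : Fin n, i + k * l i < m := by
    intro i
    rw [← div_lt_residueCount_iff hk, hdiv, hmod]
    have h1 := (div_lt_residueCount_iff hk n i).2 i.2
    have h2 := residueCount_mono (k := k) hnm (i % k)
    have h3 := hl i
    omega
  have hcast : ∀ i j : Fin n, ((((i + k * l i) / k : ℕ) : F) = ((j + k * l j) / k : ℕ)) →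
      (i + k * l i) / k = (j + k * l j) / k := by
    intro i j h
    rcases hp with hp | ⟨-, hp⟩
    · have : CharP F 0 := ringChar.of_eq hp
      have := CharP.charP_to_charZero F
      exact Nat.cast_injective h
    · have hlt' : ∀ i : Fin n, (i + k * l i) / k < ringChar F := fun i =>
        Nat.div_lt_of_lt_mul ((hlt i).trans_le hp)
      exact CharP.natCast_injOn_Iio F (ringChar F) (hlt' i) (hlt' j) h
  refine powerSumValuesExceed_of_exponents hk ?_ hlt hmod ?_ ?_
  · rcases hp with hp | ⟨hp, -⟩
    · have : CharP F 0 := ringChar.of_eq hp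
      have := CharP.charP_to_charZero F
      exact_mod_cast s.factorial_ne_zero
    · have hprime : (ringChar F).Prime :=
        (CharP.char_is_prime_or_zero F (ringChar F)).resolve_right (by omega)
      rw [Ne, ringChar.spec, hprime.dvd_factorial]
      omega
  · rw [Finset.sum_add_distrib, ← Finset.mul_sum, hsum]
  · intro i j hij h
    have heq := hcast i j h
    rw [hdiv, hdiv] at heq
    by_contra hne
    have key : ∀ i j : Fin n, i < j → (i : ℕ) % k = j % k → i / k + l i ≠ j / k + l j := by
      intro i j hlt hij heq
      have h1 := Nat.mod_add_div (i : ℕ) k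
      have h2 := Nat.mod_add_div (j : ℕ) k
      have h3 := hmono i j hlt hij
      have h4 : (i : ℕ) < j := hlt
      have h5 := Nat.mul_le_mul_left k (show (j : ℕ) / k ≤ i / k by omega)
      omega
    rcases lt_or_gt_of_ne hne with h | h
    · exact key i j h hij heq
    · exact key j i h hij.symm heq.symm

/-- The number of values exceeds every `s` that is at most the maximal excess and below the
characteristic. -/
theorem powerSumValuesExceed_min {F : Type*} [Field F] {k n m s : ℕ} (hk : 0 < k) (hnm : n ≤ m)
    (hs : s ≤ maxExcess k n m) (hp : ringChar F = 0 ∨ s < ringChar F) :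
    PowerSumValuesExceed F k n m s := by
  rcases hp with hp | hp
  · exact powerSumValuesExceed_of_le_maxExcess hk hnm hs (Or.inl hp)
  have hprime : (ringChar F).Prime :=
    (CharP.char_is_prime_or_zero F (ringChar F)).resolve_right (by omega)
  set p := ringChar F with hpdef
  by_cases hm : m ≤ k * p
  · exact powerSumValuesExceed_of_le_maxExcess hk hnm hs (Or.inr ⟨hp, hm⟩)
  rcases Nat.eq_zero_or_pos s with rfl | hs0
  · exact powerSumValuesExceed_zero hnm
  have hn0 : 0 < n := by
    by_contra h
    obtain rfl : n = 0 := by omega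
    simp [maxExcess] at hs
    omega
  have hne : n ≠ m := by
    rintro rfl
    simp [maxExcess] at hs
    omega
  have hsmall : ∀ n', 0 < n' → n' < k * p → PowerSumValuesExceed F k n' (k * p) s := by
    intro n' h0 hlt
    refine powerSumValuesExceed_of_le_maxExcess hk hlt.le ?_ (Or.inr ⟨hp, le_rfl⟩)
    refine (Nat.le_sub_one_of_lt hp).trans ?_
    have hdm := Nat.div_add_mod n' k
    have hb : n' % k < k := Nat.mod_lt _ hk
    have ha : n' / k < p := Nat.div_lt_of_lt_mul hlt
    have hM := maxExcess_eq (a := n' / k) (c := p) hb hk (by rw [hdm]; omega)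
    rw [hdm, Nat.add_zero] at hM
    set a := n' / k
    set b := n' % k
    zify [hprime.one_le]
    rw [hM]
    rw [Nat.min_zero]
    push_cast
    zify at ha hb
    have ha0 : (0 : ℤ) ≤ a := Int.natCast_nonneg a
    have hb0 : (0 : ℤ) ≤ b := Int.natCast_nonneg b
    have heq : (a : ℤ) * (k * (p - a) + 0 - b) + b * (p - a) + 0 - b =
        (k - b) * (a * (p - a)) + b * ((a + 1) * (p - a - 1)) := by ring
    rw [heq]
    rcases Nat.eq_zero_or_pos a with h | h
    · have hb1 : 1 ≤ b := by
        rw [h] at hdm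
        omega
      rw [h]
      zify at hb1
      have hp1 : (1 : ℤ) ≤ p := by exact_mod_cast hprime.one_le
      push_cast
      nlinarith
    · zify at h
      have h1 : (p : ℤ) - 1 ≤ a * (p - a) := by nlinarith
      have h2 : (a : ℤ) * (p - a) ≤ (k - b) * (a * (p - a)) := by
        have : (0 : ℤ) ≤ a * (p - a) := by nlinarith
        nlinarith
      have h3 : (0 : ℤ) ≤ b * ((a + 1) * (p - a - 1)) :=
        mul_nonneg hb0 (mul_nonneg (by omega) (by omega))
      omega
  by_cases hn : n < k * p
  · exact (hsmall n hn0 hn).mono (by omega)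
  · have hkp : 2 ≤ k * p := hprime.two_le.trans (Nat.le_mul_of_pos_left p hk)
    have := (hsmall (k * p - 1) (by omega) (by omega)).add (n - (k * p - 1))
    rw [Nat.add_sub_cancel' (by omega)] at this
    exact this.mono (by omega)

theorem leastResidue_natCast (a k : ℕ) : leastResidue (a : ℤ) k = ((a % k : ℕ) : ℝ) := by
  rw [leastResidue, ← Int.natCast_mod, Int.cast_natCast]

theorem leastResidue_nonneg (a : ℤ) {k : ℕ} (hk : 0 < k) : 0 ≤ leastResidue a k := by
  rw [leastResidue]
  exact_mod_cast Int.emod_nonneg a (by omega)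

theorem iverson_nonneg (P : Prop) : 0 ≤ iverson P := by
  unfold iverson
  split_ifs <;> norm_num

theorem maxExcess_bound_eq {k n m : ℕ} (hk : 0 < k) (hnm : n ≤ m) :
    ((n : ℝ) * ((m : ℝ) - n) - leastResidue n k * leastResidue ((m : ℤ) - n) k) / k
      + leastResidue m k * iverson (leastResidue m k < leastResidue n k) + 1 =
    (maxExcess k n m : ℝ) + 1 := by
  have hn := Nat.div_add_mod n k
  have hm := Nat.div_add_mod m k
  have hb := Nat.mod_lt n hk
  have hd := Nat.mod_lt m hk
  have hM := maxExcess_eq (a := n / k) (c := m / k) hb hd (by omega)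
  rw [hn, hm] at hM
  have hMr : (maxExcess k n m : ℝ) = ((maxExcess k n m : ℤ) : ℝ) := by push_cast; rfl
  rw [hMr, hM, leastResidue_natCast, leastResidue_natCast]
  set a := n / k
  set b := n % k
  set c := m / k
  set d := m % k
  have hkr : (k : ℝ) ≠ 0 := by exact_mod_cast hk.ne'
  have hnr : (n : ℝ) = k * a + b := by exact_mod_cast hn.symm
  have hmr : (m : ℝ) = k * c + d := by exact_mod_cast hm.symm
  have hz : (m : ℤ) - n = (d - b : ℤ) + k * (c - a) := by
    zify at hn hm
    linear_combination hn - hm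
  have hres : ∀ x : ℤ, leastResidue (x + k * (c - a)) k = leastResidue x k := fun x => by
    rw [leastResidue, leastResidue, Int.add_mul_emod_self_left]
  rw [hz, hres, iverson, Nat.cast_lt, hnr, hmr]
  push_cast
  split_ifs with h
  · have : leastResidue ((d : ℤ) - b) k = d - b + k := by
      rw [leastResidue, ← Int.add_emod_right, Int.emod_eq_of_lt (by omega) (by omega)]
      push_cast
      ring
    rw [this, min_eq_right (by exact_mod_cast h.le : (d : ℝ) ≤ b)]
    field_simp
    ring
  · have : leastResidue ((d : ℤ) - b) k = d - b := by
      rw [leastResidue, Int.emod_eq_of_lt (by omega) (by omega)]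
      push_cast
      ring
    rw [this, min_eq_left (by exact_mod_cast not_lt.1 h : (b : ℝ) ≤ d)]
    field_simp
    ring

theorem min_charOrTop_le_ncard {F : Type*} [Field F] {k n m : ℕ} (hk : 0 < k) (hnm : n ≤ m)
    (A : Fin n → Finset F) (hA : ∀ i, (A i).card = m) (g : MvPolynomial (Fin n) F)
    (hg : g.totalDegree < k) :
    min (charOrTop F) (((maxExcess k n m : ℝ) + 1 : ℝ) : EReal) ≤
      (((restrictedValueSet A ((∑ i, X i ^ k) + g)).ncard : ℝ) : EReal) := by
  have hexceed : ∀ s, s ≤ maxExcess k n m → (ringChar F = 0 ∨ s < ringChar F) →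
      s < (restrictedValueSet A ((∑ i, X i ^ k) + g)).ncard := fun s hs hp =>
    powerSumValuesExceed_min hk hnm hs hp A (fun i => (hA i).ge) g hg
  have hright : (ringChar F = 0 ∨ maxExcess k n m < ringChar F) →
      min (charOrTop F) (((maxExcess k n m : ℝ) + 1 : ℝ) : EReal) ≤
        (((restrictedValueSet A ((∑ i, X i ^ k) + g)).ncard : ℝ) : EReal) := fun hp =>
    (min_le_right _ _).trans (EReal.coe_le_coe_iff.2 (by exact_mod_cast hexceed _ le_rfl hp))
  rcases Nat.eq_zero_or_pos (ringChar F) with hp | hp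
  · exact hright (Or.inl hp)
  by_cases hM : maxExcess k n m < ringChar F
  · exact hright (Or.inr hM)
  · have := hexceed (ringChar F - 1) (by omega) (by omega)
    refine (min_le_left _ _).trans ?_
    rw [charOrTop, if_neg hp.ne', EReal.coe_le_coe_iff]
    exact_mod_cast (show ringChar F ≤ _ by omega)

theorem restrictedValueSet_C_mul_ncard {F : Type*} [Field F] {n : ℕ} (A : Fin n → Finset F)
    {c : F} (hc : c ≠ 0) (f : MvPolynomial (Fin n) F) :
    (restrictedValueSet A (C c * f)).ncard = (restrictedValueSet A f).ncard := by
  rw [← Set.ncard_image_of_injective (restrictedValueSet A f) (mul_right_injective₀ hc)]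
  congr 1
  ext y
  constructor
  · rintro ⟨x, hx, hne, rfl⟩
    exact ⟨_, ⟨x, hx, hne, rfl⟩, by simp⟩
  · rintro ⟨_, ⟨x, hx, hne, rfl⟩, rfl⟩
    exact ⟨x, hx, hne, by simp⟩

theorem bound_nonpos_of_card_lt {k n c : ℕ} (hk : 0 < k) (hkn : k ≤ n) (hc : c < n) :
    ((n : ℝ) * ((c : ℝ) - n) - leastResidue n k * leastResidue ((c : ℤ) - n) k) / k + 1 ≤ 0 := by
  have hk' : (0 : ℝ) < k := by exact_mod_cast hk
  have h1 := mul_nonneg (leastResidue_nonneg n hk) (leastResidue_nonneg ((c : ℤ) - n) hk)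
  have h2 : (c : ℝ) + 1 ≤ n := by exact_mod_cast hc
  have h3 : (k : ℝ) ≤ n := by exact_mod_cast hkn
  rw [div_add_one hk'.ne']
  exact div_nonpos_of_nonpos_of_nonneg (by nlinarith) hk'.le

theorem theorem1p3 {F : Type*} [Field F] :
    -- the lower bound for the restricted value set
    (∀ (n m k : ℕ), 0 < k → n ≤ m →
      ∀ (A : Fin n → Finset F), (∀ i, (A i).card = m) →
      ∀ (f g : MvPolynomial (Fin n) F), g.totalDegree < k → f = (∑ i, X i ^ k) + g →
        min (charOrTop F)
          ((((n : ℝ) * ((m : ℝ) - n)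
              - leastResidue n k * leastResidue ((m : ℤ) - n) k) / k
            + leastResidue m k * iverson (leastResidue m k < leastResidue n k) + 1 : ℝ) : EReal)
          ≤ (((restrictedValueSet A f).ncard : ℝ) : EReal)) ∧
    -- the conjecture of Sun for equal coefficients
    (∀ (n k : ℕ), 0 < k → k ≤ n →
      ∀ (A : Finset F) (a : Fin n → F), (∀ i, a i ≠ 0) → (∀ i j, a i = a j) →
      ∀ (f g : MvPolynomial (Fin n) F), g.totalDegree < k → f = (∑ i, C (a i) * X i ^ k) + g →
        min (charOrTop F - ((iverson (n = 2 ∧ ∃ i j, i ≠ j ∧ a i = - a j) : ℝ) : EReal))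
          ((((n : ℝ) * ((A.card : ℝ) - n)
              - leastResidue n k * leastResidue ((A.card : ℤ) - n) k) / k + 1 : ℝ) : EReal)
          ≤ (((restrictedValueSet (fun _ => A) f).ncard : ℝ) : EReal)) ∧
    -- the theorem of Dias da Silva and Hamidoune
    (∀ (n : ℕ) (A : Finset F),
        min (charOrTop F) (((n : ℝ) * ((A.card : ℝ) - n) + 1 : ℝ) : EReal)
          ≤ (((({s : F | ∃ x : Fin n → F, (∀ i, x i ∈ A) ∧ (∀ i j, i ≠ j → x i ≠ x j) ∧
                ∑ i, x i = s}).ncard : ℝ)) : EReal)) := by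
  have hfirst : ∀ (n m k : ℕ), 0 < k → n ≤ m →
      ∀ (A : Fin n → Finset F), (∀ i, (A i).card = m) →
      ∀ (f g : MvPolynomial (Fin n) F), g.totalDegree < k → f = (∑ i, X i ^ k) + g →
        min (charOrTop F)
          ((((n : ℝ) * ((m : ℝ) - n)
              - leastResidue n k * leastResidue ((m : ℤ) - n) k) / k
            + leastResidue m k * iverson (leastResidue m k < leastResidue n k) + 1 : ℝ) : EReal)
          ≤ (((restrictedValueSet A f).ncard : ℝ) : EReal) := by
    rintro n m k hk hnm A hA f g hg rfl
    rw [maxExcess_bound_eq hk hnm]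
    exact min_charOrTop_le_ncard hk hnm A hA g hg
  refine ⟨hfirst, ?_, ?_⟩
  · rintro n k hk hkn A a ha haa f g hg rfl
    rcases lt_or_ge A.card n with hc | hc
    · refine (min_le_right _ _).trans ?_
      rw [EReal.coe_le_coe_iff]
      exact (bound_nonpos_of_card_lt hk hkn hc).trans (Nat.cast_nonneg _)
    · set c := a ⟨0, by omega⟩ with hcdef
      have hc0 : c ≠ 0 := ha _
      have hf : (∑ i, C (a i) * X i ^ k) + g =
          C c * ((∑ i, X i ^ k) + C c⁻¹ * g) := by
        rw [mul_add, ← mul_assoc, ← C_mul, mul_inv_cancel₀ hc0, C_1, one_mul, Finset.mul_sum]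
        simp only [haa _ ⟨0, by omega⟩, hcdef]
      have hdeg : (C c⁻¹ * g).totalDegree < k :=
        ((totalDegree_mul _ _).trans (by rw [totalDegree_C, zero_add])).trans_lt hg
      rw [hf, restrictedValueSet_C_mul_ncard _ hc0]
      refine le_trans (min_le_min ?_ ?_)
        (hfirst n A.card k hk hc (fun _ => A) (fun _ => rfl) _ _ hdeg rfl)
      · have := EReal.sub_le_sub (le_refl (charOrTop F))
          (EReal.coe_nonneg.2 (iverson_nonneg (n = 2 ∧ ∃ i j, i ≠ j ∧ a i = - a j)))
        rwa [sub_zero] at this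
      · rw [EReal.coe_le_coe_iff]
        have := mul_nonneg (leastResidue_nonneg A.card hk)
          (iverson_nonneg (leastResidue A.card k < leastResidue n k))
        linarith
  · intro n A
    rcases lt_or_ge A.card n with hc | hc
    · refine (min_le_right _ _).trans ?_
      rw [EReal.coe_le_coe_iff]
      refine le_trans ?_ (Nat.cast_nonneg _)
      have h2 : (A.card : ℝ) + 1 ≤ n := by exact_mod_cast hc
      have h3 : (1 : ℝ) ≤ n := by exact_mod_cast (show 1 ≤ n by omega)
      nlinarith
    · have := hfirst n A.card 1 one_pos hc (fun _ => A) (fun _ => rfl) _ 0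
        (by rw [totalDegree_zero]; exact one_pos) rfl
      simpa [leastResidue, restrictedValueSet, Int.emod_one] using this

end
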